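/- Let $N$ be a finite set of players. For each $i\in N$ let $X_i$ be a nonempty convex compact metrizable subset of a real locally convex topological vector space $E_i$, put $X=\prod_{i\in N}X_i$ and $X_{-i}=\prod_{j\neq i}X_j$, write $x_{-i}\in X_{-i}$ for $x\in X$ without its $i$-th entry, and let $C_i$ be a nonempty subset of $X$ (so that $((X_i)_{i\in N},(C_i)_{i\in N})$ is a game in choice form). For $x_{-i}\in X_{-i}$ let $C_i(x_{-i})=\{y_i\in X_i:(x_{-i},y_i)\in C_i\}$ be the upper section of $C_i$ at $x_{-i}$, and let $W_i=\{x_{-i}\in X_{-i}: C_i(x_{-i})\neq\emptyset\}$. Assume that, for each $i\in N$: (b) $W_i$ is a finite-dimensional simplex, i.e. the convex hull of $n_i\geq 1$ affinely independent points of $\prod_{j\ne i}E_j$, for some integer $n_i$; (c) there is a correspondence $S_i:W_i\to 2^{X_i}$ with weakly convex graph such that $S_i(x_{-i})\subseteq C_i(x_{-i})$ for each $x_{-i}\in W_i$; here $S_i$ has weakly convex graph if for every finite set $\{z_1,\dots,z_n\}\subseteq W_i$ there are $y_k\in S_i(z_k)$ $(k=1,\dots,n)$ such that the convex hull of $\{(z_1,y_1),\dots,(z_n,y_n)\}$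 is contained in the graph $\{(z,y): z\in W_i,\ y\in S_i(z)\}$; (d) $C_i(x_{-i})$ is convex or empty for each $x_{-i}\in X_{-i}$. Then the game admits an equilibrium in choice: there is $x^*\in X$ such that, for every $i\in N$, if $(\{x^*_{-i}\}\times X_i)\cap C_i\neq\emptyset$, then $x^*\in C_i$. -/

import Mathlib

/-- The graph over the domain `K` of the correspondence `T` from `K` to subsets of `F`
(the values of `T` off `K` are ignored). -/
def corrGraph {E F : Type*} (K : Set E) (T : E → Set F) : Set (E × F) :=
  {p | p.1 ∈ K ∧ p.2 ∈ T p.1}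

/-- The correspondence `T` on `K` has weakly convex graph (is WCG): for all points
`x₁, …, xₙ` of `K` there are `yₖ ∈ T(xₖ)` such that the convex hull of the pairs `(xₖ, yₖ)` is
contained in the graph of `T`. -/
def HasWeaklyConvexGraph {E F : Type*} [AddCommGroup E] [Module ℝ E] [AddCommGroup F] [Module ℝ F]
    (K : Set E) (T : E → Set F) : Prop :=
  ∀ (n : ℕ) (x : Fin n → E), (∀ k, x k ∈ K) →
    ∃ y : Fin n → F, (∀ k, y k ∈ T (x k)) ∧
      convexHull ℝ (Set.range fun k => (x k, y k)) ⊆ corrGraph K T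

/-- `K` is the (closed) `d`-dimensional simplex spanned by `d + 1` affinely independent points. -/
def IsSimplexOfDim {V : Type*} [AddCommGroup V] [Module ℝ V] (d : ℕ) (K : Set V) : Prop :=
  ∃ s : Affine.Simplex ℝ V d, K = convexHull ℝ (Set.range s.points)

/-- A game in choice form with player set `ι`: each player `i` has a nonempty set `X i` of
individual strategies (a subset of `E i`), and `(C i)` is a choice profile, a family of nonempty
subsets of the product of the sets `X i`. -/
structure ChoiceGame {ι : Type*} (E : ι → Type*) where
  /-- the individual strategies of each player -/
  X : ∀ i, Set (E i)
  /-- the choice profile -/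
  C : ι → Set (∀ i, E i)
  X_nonempty : ∀ i, (X i).Nonempty
  C_subset : ∀ i, C i ⊆ Set.univ.pi X
  C_nonempty : ∀ i, (C i).Nonempty

namespace ChoiceGame

variable {ι : Type*} {E : ι → Type*}

/-- The set `X = ∏ X_i` of game strategies. -/
def strategies (G : ChoiceGame E) : Set (∀ i, E i) := Set.univ.pi G.X

/-- The set `X_{-i} = ∏_{j ≠ i} X_j`. -/
def strategiesOthers (G : ChoiceGame E) (i : ι) : Set (∀ j : {j // j ≠ i}, E j) :=
  Set.univ.pi fun j => G.X j

/-- `x_{-i}`, the vector `x` without its `i`-th entry. -/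
def others (i : ι) (x : ∀ i, E i) : ∀ j : {j // j ≠ i}, E j := fun j => x j

/-- `(z, y)` with `z` indexed by the players other than `i`: the vector whose `i`-th entry is `y`
and whose other entries are those of `z`. -/
def combine [DecidableEq ι] (i : ι) (z : ∀ j : {j // j ≠ i}, E j) (y : E i) : ∀ i, E i :=
  (Equiv.piSplitAt i E).symm (y, z)

/-- The upper section `C_i(z) = {y ∈ X_i : (z, y) ∈ C_i}`. -/
def upperSection [DecidableEq ι] (G : ChoiceGame E) (i : ι) (z : ∀ j : {j // j ≠ i}, E j) :
    Set (E i) :=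
  {y | y ∈ G.X i ∧ combine i z y ∈ G.C i}

/-- `W_i = {z ∈ X_{-i} : C_i(z) ≠ ∅}`. -/
def choiceDomain [DecidableEq ι] (G : ChoiceGame E) (i : ι) : Set (∀ j : {j // j ≠ i}, E j) :=
  {z | z ∈ G.strategiesOthers i ∧ (G.upperSection i z).Nonempty}

/-- `x ∈ X` is an equilibrium in choice if for each player `i`,
`(x_{-i}, X_i) ∩ C_i ≠ ∅` implies `x ∈ C_i`. -/
def IsEquilibriumInChoice [DecidableEq ι] (G : ChoiceGame E) (x : ∀ i, E i) : Prop :=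
  x ∈ G.strategies ∧
    ∀ i, ((combine i (others i x) '' G.X i) ∩ G.C i).Nonempty → x ∈ G.C i

end ChoiceGame

/-!
For each player `i`, weak convexity of the graph of `S_i`, used at the vertices `p_k` of the simplex
`W_i` only, gives points `y_k` such that `∑ w_k y_k ∈ S_i (∑ w_k p_k)` for all weights `w`
(`HasWeaklyConvexGraph.exists_linearCombination_mem`). The barycentric coordinates on `W_i` are
continuous, because `W_i` is the image of a compact standard simplex in the Hausdorff space `X_{-i}`,
and by Tietze's theorem they extend to a continuous map `g_i` from `X_{-i}` to the standard simplex
(`exists_extension_baryCoords`). A family of weights `(w_i)` determines a strategy profile `x(w)`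
with `i`-th entry `∑ w_{i,k} y_{i,k}`, and `w ↦ (g_i (x(w)_{-i}))_i` is a continuous self-map of a
finite product of standard simplices. At a fixed point `w`, the profile `x = x(w)` is an equilibrium:
if `C_i (x_{-i})` is nonempty, then `x_{-i} ∈ W_i`, so `w_i` consists of the barycentric coordinates
of `x_{-i}` and `x_i ∈ S_i (x_{-i}) ⊆ C_i (x_{-i})`.

Fixed points come from Brouwer's theorem, which is proved here for cubes
(`exists_fixedPoint_of_mapsTo_cube`) and transferred to products of simplices by a retraction. The
combinatorial core is the discrete Poincaré–Miranda theorem `exists_cell_both_labels`: bits on the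
points of a grid, the `k`-th of which is `0` on the facet `x_k = 0` and `1` on the opposite facet,
all take both values in some common cell. To prove it, the discrete Jacobian mod 2 of the bits is
summed over the cells. Since it is a divergence, the sum reduces to the facets, and by induction on
the dimension it equals `1`; so the Jacobian does not vanish in some cell, and there every bit varies.
-/

/-! ### A mod 2 discrete Jacobian on the lattice -/

section discrete
variable {κ : Type*} [DecidableEq κ]

/-- The translate of a lattice point by one unit in the direction `k`. -/
def shift (k : κ) (a : κ → ℕ) : κ → ℕ := Function.update a k (a k + 1)

lemma shift_comm (k l : κ) (a : κ → ℕ) : shift k (shift l a) = shift l (shift k a) := by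
  rcases eq_or_ne k l with rfl | h
  · rfl
  · simp [shift, h, h.symm, Function.update_comm h]

lemma shift_of_ne {k j : κ} (h : j ≠ k) (a : κ → ℕ) : shift k a j = a j := by
  simp [shift, h]

lemma le_shift (k : κ) (a : κ → ℕ) : a ≤ shift k a :=
  le_update_iff.2 ⟨Nat.le_succ _, fun _ _ => le_rfl⟩

/-- The mod 2 discrete Jacobian of the functions `b i`, `i ∈ is`, in the directions `K`, defined by
expansion along the first function, with differences in place of derivatives. It is the value on
the lattice cube at `a` spanned by `K` of the cup product of the coboundaries `δ (b i)`; this is why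
the remaining factors are evaluated at the shifted point. Coefficients in `ZMod 2` make signs
unnecessary. The value is meaningful for `K.card = is.length` only. -/
def discreteJacobian (b : κ → (κ → ℕ) → ZMod 2) : List κ → Finset κ → (κ → ℕ) → ZMod 2
  | [], _, _ => 1
  | i :: is, K, a =>
    ∑ k ∈ K, (b i (shift k a) - b i a) * discreteJacobian b is (K.erase k) (shift k a)

/-- Mod 2, the terms of a symmetric sum off the diagonal cancel in pairs. -/
lemma sum_offDiag_eq_zero {K : Finset κ} (f : κ → κ → ZMod 2) (hf : ∀ k l, f k l = f l k) :
    ∑ k ∈ K, ∑ l ∈ K.erase k, f k l = 0 := by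
  induction K using Finset.induction_on with
  | empty => simp
  | insert x s hx ih =>
    rw [Finset.sum_insert hx, Finset.erase_insert hx]
    have : ∀ k ∈ s, ∑ l ∈ (insert x s).erase k, f k l = f x k + ∑ l ∈ s.erase k, f k l := by
      intro k hk
      have hne : x ≠ k := fun h => hx (h ▸ hk)
      rw [Finset.erase_insert_of_ne hne, Finset.sum_insert (by simp [hx]), hf]
    rw [Finset.sum_congr rfl this, Finset.sum_add_distrib, ih, add_zero]
    exact CharTwo.add_self_eq_zero _

/-- The maximal minors of a discrete Jacobian are divergence free: mod 2, a product of coboundaries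
is a cocycle. -/
lemma sum_diff_discreteJacobian (b : κ → (κ → ℕ) → ZMod 2) (is : List κ) (K : Finset κ)
    (a : κ → ℕ) :
    ∑ k ∈ K, (discreteJacobian b is (K.erase k) (shift k a)
      - discreteJacobian b is (K.erase k) a) = 0 := by
  induction is generalizing K a with
  | nil => simp [discreteJacobian]
  | cons i is ih =>
    -- Apply the product rule to each term of the expansion along `b i`: the second differences of
    -- `b i` are symmetric in `k, l` and cancel, the other terms vanish by induction.
    have key : ∀ k ∈ K, discreteJacobian b (i :: is) (K.erase k) (shift k a)
        - discreteJacobian b (i :: is) (K.erase k) a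
        = (∑ l ∈ K.erase k,
            ((b i (shift l (shift k a)) - b i (shift k a)) - (b i (shift l a) - b i a)) *
              discreteJacobian b is ((K.erase k).erase l) (shift l (shift k a)))
          + ∑ l ∈ K.erase k, (b i (shift l a) - b i a) *
            (discreteJacobian b is ((K.erase k).erase l) (shift k (shift l a))
              - discreteJacobian b is ((K.erase k).erase l) (shift l a)) := by
      intro k _
      simp only [discreteJacobian]
      rw [← Finset.sum_sub_distrib, ← Finset.sum_add_distrib]
      refine Finset.sum_congr rfl fun l _ => ?_
      rw [shift_comm k l]
      ring
    rw [Finset.sum_congr rfl key, Finset.sum_add_distrib, sum_offDiag_eq_zero, zero_add]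
    · rw [Finset.sum_comm' (t' := K) (s' := fun l => K.erase l)]
      · refine Finset.sum_eq_zero fun l _ => ?_
        rw [← Finset.mul_sum]
        have := ih (K.erase l) (shift l a)
        simp only [Finset.erase_right_comm (a := l)] at this
        rw [this, mul_zero]
      · intro k l
        simp only [Finset.mem_erase]
        tauto
    · intro k l
      rw [Finset.erase_right_comm, shift_comm k l]
      ring

/-- The discrete Jacobian is a divergence: `δ b ∪ c = δ (b ∪ c)` for a cocycle `c`. -/
lemma discreteJacobian_eq_sum_diff (b : κ → (κ → ℕ) → ZMod 2) (i : κ) (is : List κ) (K : Finset κ)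
    (a : κ → ℕ) :
    discreteJacobian b (i :: is) K a =
      ∑ k ∈ K, (b i (shift k a) * discreteJacobian b is (K.erase k) (shift k a)
        - b i a * discreteJacobian b is (K.erase k) a) := by
  have h : ∀ k ∈ K, b i (shift k a) * discreteJacobian b is (K.erase k) (shift k a)
        - b i a * discreteJacobian b is (K.erase k) a
      = (b i (shift k a) - b i a) * discreteJacobian b is (K.erase k) (shift k a)
        + b i a * (discreteJacobian b is (K.erase k) (shift k a)
          - discreteJacobian b is (K.erase k) a) := fun k _ => by ring
  rw [Finset.sum_congr rfl h, Finset.sum_add_distrib, ← Finset.mul_sum,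
    sum_diff_discreteJacobian, mul_zero, add_zero, discreteJacobian]

/-- A discrete Jacobian along a face on which one of its functions is constant vanishes. -/
lemma discreteJacobian_eq_zero_of_face (b : κ → (κ → ℕ) → ZMod 2) {j k : κ} {t : ℕ} {c : ZMod 2}
    (hb : ∀ a, a k = t → b j a = c) {is : List κ} (hj : j ∈ is) {K : Finset κ} (hk : k ∉ K)
    {a : κ → ℕ} (ha : a k = t) : discreteJacobian b is K a = 0 := by
  induction is generalizing K a with
  | nil => simp at hj
  | cons i is ih =>
    refine Finset.sum_eq_zero fun l hl => ?_
    have hs : shift l a k = t := by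
      rw [shift_of_ne (fun h : k = l => hk (h ▸ hl)), ha]
    rcases List.mem_cons.1 hj with rfl | hj
    · rw [hb _ ha, hb _ hs, sub_self, zero_mul]
    · rw [ih hj (fun h => hk (Finset.mem_of_mem_erase h)) hs, mul_zero]

lemma exists_edge_of_discreteJacobian_ne_zero (b : κ → (κ → ℕ) → ZMod 2) {is : List κ}
    {K : Finset κ} {a : κ → ℕ} (h : discreteJacobian b is K a ≠ 0) {j : κ} (hj : j ∈ is) :
    ∃ (p : κ → ℕ) (k : κ), b j (shift k p) ≠ b j p ∧ a ≤ p ∧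
      ∀ l, shift k p l ≤ a l + if l ∈ K then 1 else 0 := by
  induction is generalizing K a with
  | nil => simp at hj
  | cons i is ih =>
    obtain ⟨k, hk, hne⟩ := Finset.exists_ne_zero_of_sum_ne_zero h
    rcases List.mem_cons.1 hj with rfl | hj
    · refine ⟨a, k, fun h => hne (by rw [h, sub_self, zero_mul]), le_rfl, fun l => ?_⟩
      rcases eq_or_ne l k with rfl | hl
      · simp [shift, hk]
      · simp [shift_of_ne hl]
    · obtain ⟨p, k', hp, hle, hge⟩ := ih (right_ne_zero_of_mul hne) hj
      refine ⟨p, k', hp, (le_shift k a).trans hle, fun l => (hge l).trans ?_⟩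
      rcases eq_or_ne l k with rfl | hl
      · simp [shift, hk]
      · simp [shift_of_ne hl, hl]

variable [Fintype κ]

/-- The base points of the unit cubes in the directions `K` that subdivide the `K`-face of side `m`
through `c`: the coordinates in `K` run through `0, …, m - 1`, the others are those of `c`. -/
def gridBox (m : ℕ) (K : Finset κ) (c : κ → ℕ) : Finset (κ → ℕ) :=
  Fintype.piFinset fun j => if j ∈ K then Finset.range m else {c j}

/-- Summation by parts in the direction `k`: only the two faces orthogonal to `k` remain. -/
lemma sum_gridBox_diff (m : ℕ) {K : Finset κ} {k : κ} (hk : k ∈ K) (c : κ → ℕ)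
    (g : (κ → ℕ) → ZMod 2) :
    ∑ a ∈ gridBox m K c, (g (shift k a) - g a) =
      ∑ a ∈ gridBox m (K.erase k) (Function.update c k m), g a
        - ∑ a ∈ gridBox m (K.erase k) (Function.update c k 0), g a := by
  -- Cut the box into slices `a k = t`; translation by `shift k` takes each slice to the next.
  have hslice : ∀ t ∈ Finset.range m, (gridBox m K c).filter (fun a => a k = t)
      = gridBox m (K.erase k) (Function.update c k t) := by
    intro t ht
    ext a
    simp only [gridBox, Finset.mem_filter, Fintype.mem_piFinset]
    constructor
    · rintro ⟨h, rfl⟩ j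
      by_cases hj : j = k
      · subst hj; simp
      · simpa [hj] using h j
    · intro h
      refine ⟨fun j => ?_, by simpa using h k⟩
      by_cases hj : j = k
      · subst hj
        have := h j
        simp_all
      · simpa [hj] using h j
  have hshift : ∀ t, ∑ a ∈ gridBox m (K.erase k) (Function.update c k t), g (shift k a)
      = ∑ a ∈ gridBox m (K.erase k) (Function.update c k (t + 1)), g a := by
    intro t
    refine Finset.sum_nbij' (shift k) (fun a => Function.update a k t) ?_ ?_ ?_ ?_ ?_
    · intro a ha
      simp only [gridBox, Fintype.mem_piFinset] at ha ⊢
      intro j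
      have := ha j
      by_cases hj : j = k
      · subst hj; simp_all [shift]
      · simpa [hj, shift] using this
    · intro a ha
      simp only [gridBox, Fintype.mem_piFinset] at ha ⊢
      intro j
      have := ha j
      by_cases hj : j = k
      · subst hj; simp_all
      · simpa [hj] using this
    · intro a ha
      simp only [gridBox, Fintype.mem_piFinset] at ha
      have := ha k
      simp at this
      simp [shift, ← this]
    · intro a ha
      simp only [gridBox, Fintype.mem_piFinset] at ha
      have := ha k
      simp at this
      simp [shift, ← this]
    · intros; rfl
  rw [← Finset.sum_fiberwise_of_maps_to (t := Finset.range m) (g := fun a => a k)]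
  · rw [Finset.sum_congr rfl fun t ht => by
      rw [hslice t ht, Finset.sum_sub_distrib, hshift t]]
    exact Finset.sum_range_sub
      (fun t => ∑ a ∈ gridBox m (K.erase k) (Function.update c k t), g a) m
  · intro a ha
    simpa [hk] using Fintype.mem_piFinset.1 ha k

/-- The discrete form of the statement that a map of the cube preserving each facet has degree one.
By the divergence formula the sum is a boundary sum. On the facets orthogonal to `k ≠ i` the function
`b k` is constant and on the facet `a i = 0` the first factor vanishes, so only the facet `a i = m`
contributes, and it does so by the same sum in one dimension less. -/
lemma sum_gridBox_discreteJacobian (m : ℕ) (b : κ → (κ → ℕ) → ZMod 2)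
    (h0 : ∀ k a, a k = 0 → b k a = 0) (h1 : ∀ k a, a k = m → b k a = 1)
    (is : List κ) (his : is.Nodup) (c : κ → ℕ) :
    ∑ a ∈ gridBox m is.toFinset c, discreteJacobian b is is.toFinset a = 1 := by
  induction is generalizing c with
  | nil => simp [discreteJacobian, gridBox]
  | cons i is ih =>
    have hi : i ∉ is.toFinset := by simpa using (List.nodup_cons.1 his).1
    have hmem : ∀ (k : κ) (t : ℕ) (K : Finset κ), k ∉ K → ∀ a ∈ gridBox m K (Function.update c k t),
        a k = t := by
      intro k t K hk a ha
      simpa [hk] using Fintype.mem_piFinset.1 ha k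
    simp only [discreteJacobian_eq_sum_diff, List.toFinset_cons]
    rw [Finset.sum_comm, Finset.sum_congr rfl fun k hk => sum_gridBox_diff m hk c
      (fun a => b i a * discreteJacobian b is ((insert i is.toFinset).erase k) a)]
    rw [Finset.sum_insert hi, Finset.erase_insert hi, Finset.sum_eq_zero (s := is.toFinset),
      Finset.sum_congr rfl (fun a ha => by rw [h1 i a (hmem i m _ hi a ha), one_mul]),
      ih (List.nodup_cons.1 his).2, Finset.sum_eq_zero (fun a ha => by
        rw [h0 i a (hmem i 0 _ hi a ha), zero_mul]), sub_zero, add_zero]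
    intro k hk
    have hk' : k ∈ is := by simpa using hk
    rw [Finset.sum_eq_zero, Finset.sum_eq_zero, sub_self]
    · intro a ha
      rw [discreteJacobian_eq_zero_of_face b (h0 k) hk' (Finset.notMem_erase _ _)
        (hmem k 0 _ (Finset.notMem_erase _ _) a ha), mul_zero]
    · intro a ha
      rw [discreteJacobian_eq_zero_of_face b (h1 k) hk' (Finset.notMem_erase _ _)
        (hmem k m _ (Finset.notMem_erase _ _) a ha), mul_zero]

/-- A discrete Poincaré–Miranda theorem (Kuhn's lemma): if the bit `b k` is `0` on the facet `a k = 0`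
and `1` on the facet `a k = m`, then in some unit cube every bit takes both values. -/
theorem exists_cell_both_labels (m : ℕ) (b : κ → (κ → ℕ) → ZMod 2)
    (h0 : ∀ k a, a k = 0 → b k a = 0) (h1 : ∀ k a, a k = m → b k a = 1) :
    ∃ a : κ → ℕ, (∀ k, a k < m) ∧ ∀ j, ∃ p q : κ → ℕ, b j p = 0 ∧ b j q = 1 ∧
      (∀ k, a k ≤ p k ∧ p k ≤ a k + 1) ∧ ∀ k, a k ≤ q k ∧ q k ≤ a k + 1 := by
  have huniv : (Finset.univ.toList : List κ).toFinset = Finset.univ := Finset.toList_toFinset _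
  have hsum := sum_gridBox_discreteJacobian m b h0 h1 Finset.univ.toList (Finset.nodup_toList _) 0
  rw [huniv] at hsum
  obtain ⟨a, ha, hne⟩ := Finset.exists_ne_zero_of_sum_ne_zero (hsum.trans_ne one_ne_zero)
  refine ⟨a, fun k => by simpa using Fintype.mem_piFinset.1 ha k, fun j => ?_⟩
  obtain ⟨p, k, hp, hle, hge⟩ :=
    exists_edge_of_discreteJacobian_ne_zero b hne (Finset.mem_toList.2 (Finset.mem_univ j))
  simp only [Finset.mem_univ, if_true] at hge
  have hp' : ∀ l, a l ≤ p l ∧ p l ≤ a l + 1 := fun l => ⟨hle l, (le_shift k p l).trans (hge l)⟩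
  have hs' : ∀ l, a l ≤ shift k p l ∧ shift k p l ≤ a l + 1 :=
    fun l => ⟨(hle l).trans (le_shift k p l), hge l⟩
  have hbit : ∀ x y : ZMod 2, x ≠ y → x = 0 ∧ y = 1 ∨ x = 1 ∧ y = 0 := by decide
  rcases hbit _ _ hp with ⟨hx, hy⟩ | ⟨hx, hy⟩
  · exact ⟨_, _, hx, hy, hs', hp'⟩
  · exact ⟨_, _, hy, hx, hp', hs'⟩

end discrete

/-! ### Brouwer's theorem for cubes and for products of simplices -/

open Set Filter Topology

/-- **Brouwer's fixed point theorem** for the cube. -/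
theorem exists_fixedPoint_of_mapsTo_cube {κ : Type*} [Finite κ] {f : (κ → ℝ) → κ → ℝ}
    (hf : ContinuousOn f (Icc 0 1)) (hmaps : MapsTo f (Icc 0 1) (Icc 0 1)) :
    ∃ x ∈ Icc (0 : κ → ℝ) 1, f x = x := by
  classical
  have := Fintype.ofFinite κ
  -- Near some point `c n`, every `f x j - x j` takes both a nonnegative and a nonpositive value.
  -- An accumulation point of the `c n` is then fixed by continuity.
  have hgrid : ∀ n : ℕ, ∃ c ∈ Icc (0 : κ → ℝ) 1, ∀ j, ∃ p ∈ Icc (0 : κ → ℝ) 1,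
      ∃ q ∈ Icc (0 : κ → ℝ) 1, p j ≤ f p j ∧ f q j ≤ q j ∧
        dist p c ≤ 1 / ((n : ℝ) + 1) ∧ dist q c ≤ 1 / ((n : ℝ) + 1) := by
    intro n
    have hm : (0 : ℝ) < (n : ℝ) + 1 := by positivity
    set x : (κ → ℕ) → κ → ℝ := fun a k => (a k : ℝ) / ((n : ℝ) + 1) with hx
    have hxmem : ∀ a : κ → ℕ, (∀ k, a k ≤ n + 1) → x a ∈ Icc (0 : κ → ℝ) 1 := fun a ha =>
      ⟨fun k => by simp only [hx, Pi.zero_apply]; positivity, fun k => by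
        simp only [hx, Pi.one_apply]
        rw [div_le_one hm]
        exact_mod_cast ha k⟩
    -- The bit `k` of a grid point records the sign of `f x k - x k`; on the two facets orthogonal to
    -- `k`, where the bit is prescribed, the sign is right because `f` takes values in the cube.
    obtain ⟨a, ha, hpq⟩ := exists_cell_both_labels (n + 1)
      (fun k a => if a k = 0 ∨ (a k ≠ n + 1 ∧ x a k ≤ f (x a) k) then 0 else 1)
      (fun k a h => by simp [h]) (fun k a h => by simp [h])
    have hd : ∀ p : κ → ℕ, (∀ k, a k ≤ p k ∧ p k ≤ a k + 1) →
        dist (x p) (x a) ≤ 1 / ((n : ℝ) + 1) := by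
      intro p hp
      refine (dist_pi_le_iff (by positivity)).2 fun k => ?_
      have h1 : (a k : ℝ) ≤ p k := by exact_mod_cast (hp k).1
      have h2 : (p k : ℝ) ≤ a k + 1 := by exact_mod_cast (hp k).2
      rw [Real.dist_eq, ← sub_div, abs_of_nonneg (div_nonneg (by linarith) hm.le)]
      gcongr
      linarith
    have hle : ∀ p : κ → ℕ, (∀ k, a k ≤ p k ∧ p k ≤ a k + 1) → ∀ k, p k ≤ n + 1 :=
      fun p hp k => (hp k).2.trans (ha k)
    refine ⟨x a, hxmem a fun k => (ha k).le, fun j => ?_⟩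
    obtain ⟨p, q, hp, hq, hap, haq⟩ := hpq j
    have hpm := hxmem p (hle p hap)
    have hqm := hxmem q (hle q haq)
    refine ⟨x p, hpm, x q, hqm, ?_, ?_, hd p hap, hd q haq⟩
    · have hp' : p j = 0 ∨ (p j ≠ n + 1 ∧ x p j ≤ f (x p) j) := by
        by_contra h
        simp [if_neg h] at hp
      rcases hp' with h | h
      · have : x p j = 0 := by simp [hx, h]
        rw [this]
        exact (hmaps hpm).1 j
      · exact h.2
    · have hq' : ¬ (q j = 0 ∨ (q j ≠ n + 1 ∧ x q j ≤ f (x q) j)) := by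
        intro h
        simp [if_pos h] at hq
      push Not at hq'
      by_cases h : q j = n + 1
      · have : x q j = 1 := by
          simp only [hx, h]
          push_cast
          exact div_self hm.ne'
        rw [this]
        exact (hmaps hqm).2 j
      · exact (hq'.2 h).le
  choose c hc p hp q hq hpf hqf hpc hqc using hgrid
  obtain ⟨x, hx, φ, hφ, hlim⟩ := (isCompact_Icc (a := (0 : κ → ℝ)) (b := 1)).tendsto_subseq hc
  have hsmall : Tendsto (fun n => 1 / (((φ n : ℕ) : ℝ) + 1)) atTop (𝓝 0) :=
    tendsto_one_div_add_atTop_nhds_zero_nat.comp hφ.tendsto_atTop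
  have hnear : ∀ u : ℕ → κ → ℝ, (∀ n, u n ∈ Icc (0 : κ → ℝ) 1) →
      (∀ n, dist (u n) (c n) ≤ 1 / ((n : ℝ) + 1)) → ∀ j,
      Tendsto (fun n => f (u (φ n)) j) atTop (𝓝 (f x j)) ∧
        Tendsto (fun n => u (φ n) j) atTop (𝓝 (x j)) := by
    intro u hu hdist j
    have hd : Tendsto (fun n => dist (c (φ n)) (u (φ n))) atTop (𝓝 0) :=
      squeeze_zero (fun _ => dist_nonneg) (fun n => by rw [dist_comm]; exact hdist _) hsmall
    have hux : Tendsto (fun n => u (φ n)) atTop (𝓝 x) := (tendsto_iff_of_dist hd).1 hlim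
    refine ⟨?_, (continuous_apply j).continuousAt.tendsto.comp hux⟩
    exact (continuous_apply j).continuousAt.tendsto.comp <| (hf x hx).tendsto.comp <|
      tendsto_nhdsWithin_iff.2 ⟨hux, Eventually.of_forall fun n => hu _⟩
  refine ⟨x, hx, funext fun j => le_antisymm ?_ ?_⟩
  · obtain ⟨h1, h2⟩ := hnear (fun n => q n j) (fun n => hq n j) (fun n => hqc n j) j
    exact le_of_tendsto_of_tendsto' h1 h2 fun n => hqf _ j
  · obtain ⟨h1, h2⟩ := hnear (fun n => p n j) (fun n => hp n j) (fun n => hpc n j) j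
    exact le_of_tendsto_of_tendsto' h2 h1 fun n => hpf _ j

/-- A retraction of `κ → ℝ` onto the standard simplex. To the positive part of `u` the positive part
of `1 - ∑ u⁺` is added in each coordinate, so that the coordinate sum is positive, and the result is
divided by its coordinate sum. -/
noncomputable def simplexRetraction {κ : Type*} [Fintype κ] [Nonempty κ] (u : κ → ℝ) : κ → ℝ :=
  fun k => (max (u k) 0 + max (1 - ∑ l, max (u l) 0) 0) /
    ∑ j, (max (u j) 0 + max (1 - ∑ l, max (u l) 0) 0)

section

variable {κ : Type*} [Fintype κ] [Nonempty κ]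

lemma simplexRetraction_denom_pos (u : κ → ℝ) :
    0 < ∑ j, (max (u j) 0 + max (1 - ∑ l, max (u l) 0) 0) := by
  rcases lt_or_ge (∑ l, max (u l) 0) 1 with h | h
  · refine Finset.sum_pos (fun j _ => ?_) Finset.univ_nonempty
    exact add_pos_of_nonneg_of_pos (le_max_right _ _) (lt_max_of_lt_left (by linarith))
  · calc (0 : ℝ) < ∑ l, max (u l) 0 := by linarith
      _ ≤ _ := Finset.sum_le_sum fun j _ => le_add_of_nonneg_right (le_max_right _ _)

lemma simplexRetraction_mem (u : κ → ℝ) : simplexRetraction u ∈ stdSimplex ℝ κ := by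
  refine ⟨fun k => div_nonneg (by positivity) (simplexRetraction_denom_pos u).le, ?_⟩
  simp only [simplexRetraction]
  rw [← Finset.sum_div]
  exact div_self (simplexRetraction_denom_pos u).ne'

lemma continuous_simplexRetraction :
    Continuous (simplexRetraction : (κ → ℝ) → κ → ℝ) := by
  refine continuous_pi fun k => Continuous.div (by fun_prop) (by fun_prop) fun u => ?_
  exact (simplexRetraction_denom_pos u).ne'

lemma simplexRetraction_of_mem {u : κ → ℝ} (hu : u ∈ stdSimplex ℝ κ) :
    simplexRetraction u = u := by
  ext k
  have h : ∀ l, max (u l) 0 = u l := fun l => max_eq_left (hu.1 l)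
  simp [simplexRetraction, h, hu.2]

instance stdSimplex.instTietzeExtension : TietzeExtension (stdSimplex ℝ κ) :=
  .of_retract ⟨((↑) : stdSimplex ℝ κ → κ → ℝ), continuous_subtype_val⟩
    ⟨fun u => ⟨simplexRetraction u, simplexRetraction_mem u⟩,
      continuous_simplexRetraction.subtype_mk _⟩ <| by
    ext1 u
    exact Subtype.ext (simplexRetraction_of_mem u.2)

end

/-- **Brouwer's fixed point theorem** for products of standard simplices, which are retracts
of cubes. -/
theorem exists_fixedPoint_pi_stdSimplex {ι : Type*} [Finite ι] {κ : ι → Type*}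
    [∀ i, Fintype (κ i)] [∀ i, Nonempty (κ i)]
    (f : C(∀ i, stdSimplex ℝ (κ i), ∀ i, stdSimplex ℝ (κ i))) : ∃ x, f x = x := by
  let r : ((Σ i, κ i) → ℝ) → ∀ i, stdSimplex ℝ (κ i) := fun u i =>
    ⟨simplexRetraction fun k => u ⟨i, k⟩, simplexRetraction_mem _⟩
  have hr : Continuous r := continuous_pi fun i =>
    (continuous_simplexRetraction.comp (by fun_prop)).subtype_mk _
  let F : ((Σ i, κ i) → ℝ) → (Σ i, κ i) → ℝ := fun u p => (f (r u) p.1 : κ p.1 → ℝ) p.2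
  have hF : Continuous F := continuous_pi fun p => (continuous_apply p.2).comp
    (continuous_subtype_val.comp ((continuous_apply p.1).comp (f.continuous.comp hr)))
  obtain ⟨u, -, hu⟩ := exists_fixedPoint_of_mapsTo_cube (f := F) hF.continuousOn fun u _ =>
    ⟨fun p => stdSimplex.zero_le (f (r u) p.1) p.2, fun p => stdSimplex.le_one (f (r u) p.1) p.2⟩
  refine ⟨r u, funext fun i => Subtype.ext ?_⟩
  have hi : (fun k => u ⟨i, k⟩) = (f (r u) i : κ i → ℝ) := funext fun k => (congrFun hu ⟨i, k⟩).symm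
  change _ = simplexRetraction fun k => u ⟨i, k⟩
  rw [hi]
  exact (simplexRetraction_of_mem (f (r u) i).2).symm

/-! ### Barycentric coordinates and affine selections -/

lemma image_linearCombination_stdSimplex {κ V : Type*} [Fintype κ] [AddCommGroup V]
    [Module ℝ V] (v : κ → V) :
    Fintype.linearCombination ℝ v '' stdSimplex ℝ κ = convexHull ℝ (range v) := by
  classical
  rw [← convexHull_rangle_single_eq_stdSimplex, LinearMap.image_convexHull, ← range_comp]
  congr 2
  ext k
  simp [Fintype.linearCombination_apply_single]

/-- The barycentric coordinates of a simplex contained in `X` extend to a continuous map from `X` to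
the standard simplex. Only `X` is required to be Hausdorff, not `V`. -/
theorem exists_extension_baryCoords {V : Type*} [AddCommGroup V] [Module ℝ V]
    [TopologicalSpace V] [IsTopologicalAddGroup V] [ContinuousSMul ℝ V] {X : Set V}
    [T2Space X] [NormalSpace X] {d : ℕ} (s : Affine.Simplex ℝ V d)
    (hs : convexHull ℝ (range s.points) ⊆ X) :
    ∃ g : C(X, stdSimplex ℝ (Fin (d + 1))), ∀ (w : stdSimplex ℝ (Fin (d + 1))) (z : X),
      (z : V) = ∑ k, w k • s.points k → g z = w := by
  have hmem : ∀ w : stdSimplex ℝ (Fin (d + 1)), ∑ k, w k • s.points k ∈ X := fun w =>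
    hs (image_linearCombination_stdSimplex s.points ▸ mem_image_of_mem _ w.2)
  let e : stdSimplex ℝ (Fin (d + 1)) → X := fun w => ⟨∑ k, w k • s.points k, hmem w⟩
  have he : Continuous e := by
    refine Continuous.subtype_mk ?_ _
    refine continuous_finsetSum _ fun k _ => Continuous.smul ?_ continuous_const
    exact (continuous_apply k).comp continuous_subtype_val
  have hinj : Function.Injective e := by
    intro w w' h
    have h' : ∑ k, w k • s.points k = ∑ k, w' k • s.points k :=
      congrArg Subtype.val h
    refine Subtype.ext ((affineIndependent_iff_eq_of_fintype_affineCombination_eq ℝ s.points).1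
      s.independent w.1 w'.1 w.2.2 w'.2.2 ?_)
    rw [Finset.affineCombination_eq_linear_combination _ _ _ w.2.2,
      Finset.affineCombination_eq_linear_combination _ _ _ w'.2.2]
    exact h'
  obtain ⟨g, hg⟩ := (ContinuousMap.id (stdSimplex ℝ (Fin (d + 1)))).exists_extension
    (he.isClosedEmbedding hinj)
  refine ⟨g, fun w z hz => ?_⟩
  have : z = ⟨∑ k, w k • s.points k, hmem w⟩ := Subtype.ext hz
  rw [this]
  exact congrArg (fun h : C(stdSimplex ℝ (Fin (d + 1)), stdSimplex ℝ (Fin (d + 1))) => h w) hg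

/-- A correspondence with weakly convex graph has a selection on the convex hull of finitely many
points that is affine in the weights. -/
theorem HasWeaklyConvexGraph.exists_linearCombination_mem {V F : Type*} [AddCommGroup V]
    [Module ℝ V] [AddCommGroup F] [Module ℝ F] {K : Set V} {S : V → Set F}
    (h : HasWeaklyConvexGraph K S) {n : ℕ} [NeZero n] (p : Fin n → V) (hp : ∀ k, p k ∈ K) :
    ∃ y : Fin n → F, (∀ k, y k ∈ S (p k)) ∧
      ∀ w ∈ stdSimplex ℝ (Fin n), ∑ k, w k • y k ∈ S (∑ k, w k • p k) := by
  obtain ⟨y, hy, hhull⟩ := h n p hp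
  refine ⟨y, hy, fun w hw => ?_⟩
  rw [← image_linearCombination_stdSimplex] at hhull
  have := (hhull (mem_image_of_mem _ hw)).2
  simpa [Fintype.linearCombination_apply, Prod.fst_sum, Prod.snd_sum] using this

/-! ### Existence of an equilibrium in choice -/

theorem theorem2 {ι : Type*} [Finite ι] [DecidableEq ι] {E : ι → Type*}
    [∀ i, AddCommGroup (E i)] [∀ i, Module ℝ (E i)] [∀ i, TopologicalSpace (E i)]
    [∀ i, IsTopologicalAddGroup (E i)] [∀ i, ContinuousSMul ℝ (E i)]
    [∀ i, LocallyConvexSpace ℝ (E i)]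
    (G : ChoiceGame E)
    (hconv : ∀ i, Convex ℝ (G.X i))
    (hcomp : ∀ i, IsCompact (G.X i))
    (hmetr : ∀ i, TopologicalSpace.MetrizableSpace (G.X i))
    (hsimplex : ∀ i, ∃ d : ℕ, IsSimplexOfDim d (G.choiceDomain i))
    (hWCG : ∀ i, ∃ S : (∀ j : {j // j ≠ i}, E j) → Set (E i),
      HasWeaklyConvexGraph (G.choiceDomain i) S ∧
        ∀ z ∈ G.choiceDomain i, S z ⊆ G.upperSection i z)
    (hsec : ∀ i, ∀ z ∈ G.strategiesOthers i, Convex ℝ (G.upperSection i z)) :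
    ∃ x, G.IsEquilibriumInChoice x := by
  choose d s hs using hsimplex
  choose S hS hSC using hWCG
  have hpts : ∀ i k, (s i).points k ∈ G.choiceDomain i := fun i k =>
    hs i ▸ subset_convexHull ℝ _ (mem_range_self k)
  have hsel : ∀ i, ∃ y : Fin (d i + 1) → E i, (∀ k, y k ∈ S i ((s i).points k)) ∧
      ∀ w ∈ stdSimplex ℝ (Fin (d i + 1)), ∑ k, w k • y k ∈ S i (∑ k, w k • (s i).points k) :=
    fun i => (hS i).exists_linearCombination_mem _ (hpts i)
  choose y hyS hysel using hsel
  have hyX : ∀ i k, y i k ∈ G.X i := fun i k => (hSC i _ (hpts i k) (hyS i k)).1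
  have hextend : ∀ i, ∃ g : C(G.strategiesOthers i, stdSimplex ℝ (Fin (d i + 1))),
      ∀ (w : stdSimplex ℝ (Fin (d i + 1))) (z : G.strategiesOthers i),
        (z : ∀ j : {j // j ≠ i}, E j) = ∑ k, w k • (s i).points k → g z = w := by
    intro i
    have : CompactSpace (G.strategiesOthers i) :=
      isCompact_iff_compactSpace.1 (isCompact_univ_pi fun j => hcomp j)
    have : T2Space (G.strategiesOthers i) := by
      -- The spaces `E j` need not be Hausdorff, but the sets `X j` are, being metrizable.
      let coords : G.strategiesOthers i → ∀ j : {j // j ≠ i}, G.X j :=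
        fun z j => ⟨z.1 j, z.2 j (mem_univ j)⟩
      have hcoords : Continuous coords := continuous_pi fun j =>
        ((continuous_apply j).comp continuous_subtype_val).subtype_mk _
      exact .of_injective_continuous (f := coords) (fun z z' h => Subtype.ext <| funext fun j =>
        congrArg Subtype.val (congrFun h j)) hcoords
    exact exists_extension_baryCoords (s i) (hs i ▸ fun z (hz : z ∈ G.choiceDomain i) => hz.1)
  choose g hg using hextend
  -- The profile in which player `i` mixes the values of the selection at the vertices of `W_i` with
  -- the weights `w i`.
  let x : (∀ i, stdSimplex ℝ (Fin (d i + 1))) → ∀ i, G.X i := fun w i =>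
    ⟨∑ k, w i k • y i k, (hconv i).sum_mem (fun k _ => (w i).2.1 k) (w i).2.2 fun k _ => hyX i k⟩
  have hx : Continuous x := by
    refine continuous_pi fun i => Continuous.subtype_mk ?_ _
    refine continuous_finsetSum _ fun k _ => Continuous.smul ?_ continuous_const
    exact (continuous_apply k).comp (continuous_subtype_val.comp (continuous_apply i))
  -- At a fixed point, the weights of each player `i` are the extended barycentric coordinates of
  -- the strategies of the others.
  obtain ⟨w, hw⟩ := exists_fixedPoint_pi_stdSimplex
    ⟨fun w i => g i ⟨fun j => x w j, fun j _ => (x w j).2⟩, by fun_prop⟩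
  refine ⟨fun i => x w i, fun i _ => (x w i).2, ?_⟩
  rintro i ⟨_, ⟨v, hv, rfl⟩, hvC⟩
  set z := ChoiceGame.others i fun i => (x w i : E i) with hz
  have hzX : z ∈ G.strategiesOthers i := fun j _ => (x w j).2
  have hzW : z ∈ G.choiceDomain i := ⟨hzX, v, hv, hvC⟩
  have hzhull := hzW
  rw [hs i, ← image_linearCombination_stdSimplex] at hzhull
  obtain ⟨c, hc, hcz⟩ := hzhull
  have hwc : w i = ⟨c, hc⟩ := (congrFun hw i).symm.trans (hg i ⟨c, hc⟩ ⟨z, hzX⟩ hcz.symm)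
  have hmem : (x w i : E i) ∈ S i z := by
    have := hysel i c hc
    rw [← Fintype.linearCombination_apply ℝ (s i).points, hcz] at this
    change ∑ k, w i k • y i k ∈ S i z
    rw [hwc]
    exact this
  have hup := (hSC i z hzW hmem).2
  have hcomb : ChoiceGame.combine i z (x w i : E i) = fun i => (x w i : E i) :=
    (Equiv.piSplitAt i E).symm_apply_apply fun i => (x w i : E i)
  rwa [hcomb] at hup
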